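/- Let $G$ be a finite group. A set $C$ of conjugacy classes of $G$ is said to generate $G$ if, for every choice of one representative in each class of $C$, these representatives generate $G$. Let $(X_n)_{n\ge 1}$ be independent random variables, each uniformly distributed on $G$, let $X_n^\sharp$ be the conjugacy class of $X_n$, and let $$\tau_G=\min\{n\ge 1 \mid \{X_1^\sharp,\dots,X_n^\sharp\}\text{ generates } G\}\in[1,+\infty].$$ Put $c(G)=\mathbf{E}(\tau_G)$ and $c_2(G)=\mathbf{E}(\tau_G^2)$ (the Chebotarev invariant and the secondary Chebotarev invariant of $G$). Theorem. Let $G$ be a non-trivial finite abelian group (written additively). For a prime $p\mid |G|$ let $r_p(G)=\dim_{\mathbf{F}_p}(G/pG)$, and let $\delta(G)=\max_{p\mid |G|} r_p(G)$. Then $c_2(G)$ is finite and $$c_2(G)=\delta(G)^2+\sum_{j\ge 1}(2j+2\delta(G)-1)\Bigl(1-\prod_{p\mid |G|}\ \prod_{1\le i\le r_p(G)}\bigl(1-p^{-(\delta(G)+j-i)}\bigr)\Bigr),$$ where $p$ runs over the primes dividing $|G|$ and the series converges absolutely. In particular, for every integer $n\ge 2$, $$c_2(\mathbf{Z}/n\mathbf{Z})=-\sum_{\substack{d\mid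 n\\ d\ge 2}}\mu(d)\,\frac{1+d^{-1}}{(1-d^{-1})^2},$$ where $\mu$ is the Möbius function, and for every prime $p$ and every integer $k\ge 1$, $c(\mathbf{F}_p^k)$ is finite and $$c_2(\mathbf{F}_p^k)=c(\mathbf{F}_p^k)^2+\sum_{1\le j\le k}\frac{p^j}{(p^j-1)^2}.$$ -/

import Mathlib

open MeasureTheory ProbabilityTheory
open scoped ENNReal

namespace Chebotarev

/-- A set `C` of conjugacy classes of `G` generates `G` if, for any choice of a
representative `g c ∈ c` of each class `c ∈ C`, these representatives generate `G`. -/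
def Generates {G : Type*} [Group G] (C : Set (ConjClasses G)) : Prop :=
  ∀ g : ConjClasses G → G, (∀ c ∈ C, g c ∈ c.carrier) → Subgroup.closure (g '' C) = ⊤

/-- The waiting time `min {n ≥ 1 | the classes of the first n terms generate G} ∈ [1, ∞]` of a
sequence in `G` (`∞` if there is no such `n`). The sequence is indexed from `0`, so that
its first `n` terms are the `x i` with `i < n`. -/
noncomputable def waitingTime {G : Type*} [Group G] (x : ℕ → G) : ℕ∞ :=
  sInf {t : ℕ∞ | ∃ n : ℕ, 1 ≤ n ∧
    Generates ((fun i => ConjClasses.mk (x i)) '' {i : ℕ | i < n}) ∧ t = n}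

/-- The Chebotarev invariant of `G` with respect to the sequence `X` of `G`-valued random
variables: the expectation of the waiting time, in `[1, ∞]`. -/
noncomputable def cheb {G Ω : Type*} [Group G] [MeasurableSpace Ω] (P : Measure Ω)
    (X : ℕ → Ω → G) : ℝ≥0∞ :=
  ∫⁻ ω, (waitingTime (fun n => X n ω) : ℝ≥0∞) ∂P

/-- The secondary Chebotarev invariant of `G` with respect to the sequence `X` of `G`-valued
random variables: the second moment of the waiting time, in `[1, ∞]`. -/
noncomputable def scheb {G Ω : Type*} [Group G] [MeasurableSpace Ω] (P : Measure Ω)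
    (X : ℕ → Ω → G) : ℝ≥0∞ :=
  ∫⁻ ω, (waitingTime (fun n => X n ω) : ℝ≥0∞) ^ 2 ∂P

/-- `X` is a sequence of independent, uniformly distributed random variables with values in the
finite set `G` (with the discrete σ-algebra). -/
structure IsIIDUniform {G Ω : Type*} [MeasurableSpace Ω] (P : Measure Ω)
    (X : ℕ → Ω → G) : Prop where
  measurable : ∀ n, @Measurable Ω G _ ⊤ (X n)
  indep : iIndepFun (m := fun _ => (⊤ : MeasurableSpace G)) X P
  uniform : ∀ n g, P {ω | X n ω = g} = 1 / (Nat.card G : ℝ≥0∞)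

/-- The `p`-rank `r_p(G) = dim_{𝔽_p} (G / pG)` of an abelian group, `G / pG` being formed in
additive notation. -/
noncomputable def pRank (G : Type*) [CommGroup G] (p : ℕ) : ℕ :=
  Module.finrank (ZMod p) (ModN (Additive G) p)

/-- `δ(G)`, the maximum of the `p`-ranks `r_p(G)` over the primes `p` dividing `|G|`. -/
noncomputable def delta (G : Type*) [CommGroup G] : ℕ :=
  (Nat.card G).primeFactors.sup (pRank G)

/-- The term of index `j ≥ 1` of the series for the secondary Chebotarev invariant of an
abelian group. -/
noncomputable def seriesTerm (G : Type*) [CommGroup G] (j : ℕ+) : ℝ :=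
  (2 * (j : ℝ) + 2 * (delta G : ℝ) - 1) *
    (1 - ∏ p ∈ (Nat.card G).primeFactors, ∏ i ∈ Finset.Icc 1 (pRank G p),
      (1 - (p : ℝ) ^ (-((delta G : ℤ) + (j : ℤ) - (i : ℤ)))))

end Chebotarev

/-! Summing tails gives `E τ = ∑ P(τ > n)` and `E τ² = ∑ (2n+1) P(τ > n)`, with `n ≥ 0`. In an
abelian group conjugacy classes are singletons, so `P(τ > n) = 1 - genProb G n`, where `genProb G n`
is the proportion of generating `n`-tuples.

A tuple generates `G` exactly when its image spans `G/pG` for every prime `p ∣ |G|`. These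
conditions are independent by the Chinese remainder theorem, and each is a count over `𝔽_p`; this is
`genProb_eq`. The product vanishes for `n < δ(G)`, so those terms sum to `δ(G)²`, and the others
form the stated series.

For `ℤ/n` the product over `p` expands into a Möbius sum of geometric series. For `𝔽_p^k`,
`one_sub_spanProb_succ_succ` says that `τ` is distributed as a sum of `k` independent geometric
variables with failure probabilities `p^{-j}`, `1 ≤ j ≤ k`. Variances add, and `p^j/(p^j-1)²` is the
variance of the `j`-th. -/

namespace Chebotarev

/-! ### Tail sums and the waiting time -/

lemma tsum_indicator_lt_eq_coe (t : ℕ∞) :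
    ∑' n : ℕ, (if (n : ℕ∞) < t then (1 : ℝ≥0∞) else 0) = (t : ℝ≥0∞) := by
  induction t with
  | top => simp
  | coe m =>
    rw [tsum_eq_sum (s := Finset.range m)]
    · rw [Finset.sum_congr rfl (g := fun _ => (1 : ℝ≥0∞))]
      · simp
      · intro i hi
        simp [Finset.mem_range.1 hi]
    · intro b hb
      simp only [Finset.mem_range] at hb
      simp [hb]

lemma tsum_indicator_lt_eq_coe_sq (t : ℕ∞) :
    ∑' n : ℕ, (if (n : ℕ∞) < t then (2 * n + 1 : ℝ≥0∞) else 0) = (t : ℝ≥0∞) ^ 2 := by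
  induction t with
  | top =>
    have h : (⊤ : ℝ≥0∞) ≤ ∑' n : ℕ, (2 * n + 1 : ℝ≥0∞) := by
      rw [← ENNReal.tsum_const_eq_top_of_ne_zero (α := ℕ) one_ne_zero]
      exact ENNReal.tsum_le_tsum fun n => le_add_self
    simpa using h
  | coe m =>
    rw [tsum_eq_sum (s := Finset.range m)]
    · rw [Finset.sum_congr rfl (g := fun n : ℕ => (2 * n + 1 : ℝ≥0∞))]
      · simp only [ENat.toENNReal_coe]
        induction m with
        | zero => simp
        | succ m ih => rw [Finset.sum_range_succ, ih]; push_cast; ring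
      · intro i hi
        simp [Finset.mem_range.1 hi]
    · intro b hb
      simp only [Finset.mem_range] at hb
      simp [hb]

lemma Generates.mono {G : Type*} [Group G] {C D : Set (ConjClasses G)} (h : Generates C)
    (hCD : C ⊆ D) : Generates D := fun g hg =>
  top_unique <| (h g fun c hc => hg c (hCD hc)).ge.trans
    (Subgroup.closure_mono (Set.image_mono hCD))

lemma not_generates_empty {G : Type*} [Group G] [Nontrivial G] :
    ¬ Generates (∅ : Set (ConjClasses G)) := by
  intro h
  have := h (fun _ => 1) (by simp)
  simp only [Set.image_empty, Subgroup.closure_empty] at this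
  exact bot_ne_top this

/-- Nontriviality makes this hold at `n = 0`: the minimum runs over `n ≥ 1`, but the empty set would
generate a trivial group. -/
lemma lt_waitingTime_iff {G : Type*} [Group G] [Nontrivial G] (x : ℕ → G) (n : ℕ) :
    (n : ℕ∞) < waitingTime x ↔
      ¬ Generates ((fun i => ConjClasses.mk (x i)) '' {i : ℕ | i < n}) := by
  have key : waitingTime x ≤ n ↔
      Generates ((fun i => ConjClasses.mk (x i)) '' {i : ℕ | i < n}) := by
    constructor
    · intro h
      have hne : {t : ℕ∞ | ∃ n : ℕ, 1 ≤ n ∧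
          Generates ((fun i => ConjClasses.mk (x i)) '' {i : ℕ | i < n}) ∧ t = n}.Nonempty := by
        by_contra hne
        rw [Set.not_nonempty_iff_eq_empty] at hne
        rw [waitingTime, hne, sInf_empty] at h
        simp at h
      obtain ⟨m, _, hm, hmt⟩ := csInf_mem hne
      rw [waitingTime, hmt, Nat.cast_le] at h
      exact hm.mono (Set.image_mono fun i (hi : i < m) => hi.trans_le h)
    · intro h
      refine sInf_le ⟨n, ?_, h, rfl⟩
      by_contra hn
      obtain rfl : n = 0 := by omega
      simp only [not_lt_zero, Set.ofPred_false, Set.image_empty] at h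
      exact not_generates_empty h
  rw [← key, not_le]

lemma generates_image_mk_iff {G ι : Type*} [CommGroup G] (x : ι → G) (s : Set ι) :
    Generates ((fun i => ConjClasses.mk (x i)) '' s) ↔ Subgroup.closure (x '' s) = ⊤ := by
  have hmem (a b : G) : a ∈ (ConjClasses.mk b).carrier ↔ a = b := by
    rw [ConjClasses.mem_carrier_iff_mk_eq, ConjClasses.mk_eq_mk_iff_isConj, isConj_iff_eq]
  constructor
  -- Any choice of representatives will do, since each class is a singleton; `Quotient.out` supplies
  -- one.
  · intro h
    have := h (fun c => Quotient.out c) (by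
      rintro c -
      rw [ConjClasses.mem_carrier_iff_mk_eq]
      exact Quotient.out_eq c)
    rwa [Set.image_image, Set.image_congr (g := x)] at this
    intro i _
    rw [← hmem, ConjClasses.mem_carrier_iff_mk_eq]
    exact Quotient.out_eq (ConjClasses.mk (x i))
  · intro h g hg
    rwa [Set.image_image, Set.image_congr (g := x)]
    intro i hi
    exact (hmem _ _).1 (hg _ (Set.mem_image_of_mem _ hi))

lemma lt_waitingTime_iff_closure {G : Type*} [CommGroup G] [Nontrivial G] (x : ℕ → G) (n : ℕ) :
    (n : ℕ∞) < waitingTime x ↔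
      (fun i : Fin n => x i) ∉ {y : Fin n → G | Subgroup.closure (Set.range y) = ⊤} := by
  rw [lt_waitingTime_iff, generates_image_mk_iff, Set.mem_ofPred_eq]
  have : x '' {i | i < n} = Set.range (fun i : Fin n => x i) := by
    ext g
    constructor
    · rintro ⟨i, hi, rfl⟩
      exact ⟨⟨i, hi⟩, rfl⟩
    · rintro ⟨i, rfl⟩
      exact ⟨i, i.2, rfl⟩
  rw [this]

/-! ### Uniform distribution of the initial tuples -/

section Tuples

variable {G Ω : Type*} [MeasurableSpace Ω] {P : Measure Ω} {X : ℕ → Ω → G}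

lemma IsIIDUniform.measurableSet_eq (h : IsIIDUniform P X) {n : ℕ} (y : Fin n → G) :
    MeasurableSet {ω | (fun i : Fin n => X i ω) = y} := by
  simp only [funext_iff, Set.ofPred_forall]
  exact MeasurableSet.iInter fun i => h.measurable i (t := {y i}) trivial

lemma IsIIDUniform.measure_eq (h : IsIIDUniform P X) {n : ℕ} (y : Fin n → G) :
    P {ω | (fun i : Fin n => X i ω) = y} = (1 / (Nat.card G : ℝ≥0∞)) ^ n := by
  classical
  have := (h.indep.precomp (g := fun i : Fin n => (i : ℕ)) Fin.val_injective)
  have := this.measure_inter_preimage_eq_mul Finset.univ (sets := fun i => {y i})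
    (fun i _ => trivial)
  simp only [Finset.mem_univ, Set.iInter_true] at this
  have hs : {ω | (fun i : Fin n => X i ω) = y} =
      ⋂ i : Fin n, (fun ω => X i ω) ⁻¹' {y i} := by
    ext ω
    simp [funext_iff]
  rw [hs]
  refine this.trans ?_
  have hu (i : Fin n) : P (X i ⁻¹' {y i}) = 1 / (Nat.card G : ℝ≥0∞) := h.uniform i (y i)
  simp [hu]

lemma IsIIDUniform.measurableSet_mem [Finite G] (h : IsIIDUniform P X) {n : ℕ}
    (A : Set (Fin n → G)) : MeasurableSet {ω | (fun i : Fin n => X i ω) ∈ A} := by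
  have : {ω | (fun i : Fin n => X i ω) ∈ A} = ⋃ y ∈ A, {ω | (fun i : Fin n => X i ω) = y} := by
    ext; simp
  rw [this]
  exact (Set.toFinite A).measurableSet_biUnion fun y _ => h.measurableSet_eq y

lemma IsIIDUniform.measure_mem [Finite G] (h : IsIIDUniform P X) {n : ℕ}
    (A : Set (Fin n → G)) :
    P {ω | (fun i : Fin n => X i ω) ∈ A} =
      (Nat.card A : ℝ≥0∞) * (1 / (Nat.card G : ℝ≥0∞)) ^ n := by
  classical
  have := Fintype.ofFinite G
  have hA : {ω | (fun i : Fin n => X i ω) ∈ A} =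
      ⋃ y ∈ A.toFinset, {ω | (fun i : Fin n => X i ω) = y} := by
    ext; simp
  rw [hA, measure_biUnion_finset]
  · simp [h.measure_eq]
  · intro y _ z _ hyz
    exact Set.disjoint_left.2 fun ω hy hz => hyz (hy.symm.trans hz)
  · intro y _
    exact h.measurableSet_eq y

lemma IsIIDUniform.measure_not_mem [IsProbabilityMeasure P] [Finite G] [Nonempty G]
    (h : IsIIDUniform P X) {n : ℕ} (A : Set (Fin n → G)) :
    P {ω | (fun i : Fin n => X i ω) ∉ A} =
      ENNReal.ofReal (1 - (Nat.card A : ℝ) / (Nat.card G : ℝ) ^ n) := by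
  have hc : {ω | (fun i : Fin n => X i ω) ∉ A} = {ω | (fun i : Fin n => X i ω) ∈ A}ᶜ := rfl
  have hG : (0 : ℝ) < Nat.card G := by exact_mod_cast Nat.card_pos
  rw [hc, prob_compl_eq_one_sub (h.measurableSet_mem A), h.measure_mem A,
    ENNReal.ofReal_sub _ (by positivity), ENNReal.ofReal_one,
    ENNReal.ofReal_div_of_pos (by positivity),
    ENNReal.ofReal_pow hG.le, ENNReal.ofReal_natCast, ENNReal.ofReal_natCast, one_div,
    ← ENNReal.inv_pow, div_eq_mul_inv]

end Tuples

/-! ### Moments as series of tail probabilities -/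

section Moments

variable {G Ω : Type*} [CommGroup G] [Finite G] [Nontrivial G] [MeasurableSpace Ω] {P : Measure Ω}
  [IsProbabilityMeasure P] {X : ℕ → Ω → G}

/-- The proportion of generating `n`-tuples in `G`. -/
noncomputable def genProb (G : Type*) [Group G] (n : ℕ) : ℝ :=
  (Nat.card {y : Fin n → G | Subgroup.closure (Set.range y) = ⊤} : ℝ) / (Nat.card G : ℝ) ^ n

lemma genProb_le_one (G : Type*) [Group G] [Finite G] (n : ℕ) : genProb G n ≤ 1 := by
  have hG : (0 : ℝ) < Nat.card G := by exact_mod_cast Nat.card_pos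
  rw [genProb, div_le_one (by positivity)]
  have := Nat.card_le_card_of_injective
    (Subtype.val : {y : Fin n → G | Subgroup.closure (Set.range y) = ⊤} → _)
    Subtype.val_injective
  rw [Nat.card_fun, Nat.card_fin] at this
  exact_mod_cast this

lemma IsIIDUniform.measure_lt_waitingTime (h : IsIIDUniform P X) (n : ℕ) :
    P {ω | (n : ℕ∞) < waitingTime (fun i => X i ω)} = ENNReal.ofReal (1 - genProb G n) := by
  simp only [lt_waitingTime_iff_closure]
  exact h.measure_not_mem _

omit [IsProbabilityMeasure P] in
lemma IsIIDUniform.measurableSet_lt_waitingTime (h : IsIIDUniform P X) (n : ℕ) :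
    MeasurableSet {ω | (n : ℕ∞) < waitingTime (fun i => X i ω)} := by
  simp only [lt_waitingTime_iff_closure]
  exact h.measurableSet_mem
    (A := {y : Fin n → G | Subgroup.closure (Set.range y) = ⊤}ᶜ)

lemma IsIIDUniform.lintegral_tsum_lt_waitingTime (h : IsIIDUniform P X) {w : ℕ → ℝ}
    (hw : ∀ n, 0 ≤ w n) (hs : Summable fun n => w n * (1 - genProb G n)) :
    ∫⁻ ω, ∑' n : ℕ, (if (n : ℕ∞) < waitingTime (fun i => X i ω)
      then ENNReal.ofReal (w n) else 0) ∂P =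
      ENNReal.ofReal (∑' n, w n * (1 - genProb G n)) := by
  have hi (n : ℕ) : (fun ω => if (n : ℕ∞) < waitingTime (fun i => X i ω)
      then ENNReal.ofReal (w n) else 0) =
      Set.indicator {ω | (n : ℕ∞) < waitingTime (fun i => X i ω)}
        (fun _ => ENNReal.ofReal (w n)) := by
    ext ω
    simp [Set.indicator_apply]
  rw [lintegral_tsum]
  · simp_rw [hi]
    rw [ENNReal.ofReal_tsum_of_nonneg
      (fun n => mul_nonneg (hw n) (sub_nonneg.2 (genProb_le_one G n))) hs]
    refine tsum_congr fun n => ?_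
    rw [lintegral_indicator_const (h.measurableSet_lt_waitingTime n), h.measure_lt_waitingTime,
      ENNReal.ofReal_mul (hw n)]
  · intro n
    rw [hi]
    exact (measurable_const.indicator (h.measurableSet_lt_waitingTime n)).aemeasurable

lemma IsIIDUniform.cheb_eq (h : IsIIDUniform P X)
    (hs : Summable fun n => 1 - genProb G n) :
    cheb P X = ENNReal.ofReal (∑' n, (1 - genProb G n)) := by
  have := h.lintegral_tsum_lt_waitingTime (w := fun _ => 1) (fun _ => zero_le_one) (by simpa using hs)
  rw [cheb]
  simpa only [ENNReal.ofReal_one, tsum_indicator_lt_eq_coe, one_mul] using this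

lemma IsIIDUniform.scheb_eq (h : IsIIDUniform P X)
    (hs : Summable fun n : ℕ => (2 * n + 1 : ℝ) * (1 - genProb G n)) :
    scheb P X = ENNReal.ofReal (∑' n : ℕ, (2 * n + 1 : ℝ) * (1 - genProb G n)) := by
  have hw (n : ℕ) : ENNReal.ofReal (2 * n + 1 : ℝ) = 2 * n + 1 := by
    rw [ENNReal.ofReal_add (by positivity) zero_le_one, ENNReal.ofReal_mul zero_le_two]
    simp
  have := h.lintegral_tsum_lt_waitingTime (w := fun n => 2 * n + 1) (fun _ => by positivity) hs
  rw [scheb]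
  simpa only [hw, tsum_indicator_lt_eq_coe_sq] using this

omit [Nontrivial G] in
lemma tsum_mul_one_sub_genProb_nonneg {w : ℕ → ℝ} (hw : ∀ n, 0 ≤ w n) :
    0 ≤ ∑' n, w n * (1 - genProb G n) :=
  tsum_nonneg fun n => mul_nonneg (hw n) (sub_nonneg.2 (genProb_le_one G n))

end Moments

/-! ### Spanning tuples over a prime field -/

/-- The probability that `n` uniformly random vectors span an `r`-dimensional vector space over
the field with `p` elements. -/
noncomputable def spanProb (p r n : ℕ) : ℝ :=
  ∏ i ∈ Finset.range r, (1 - (p : ℝ) ^ (-((n : ℤ) - (i : ℤ))))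

/-- The factor with index `i = n` is `1 - p^0 = 0`. -/
lemma spanProb_eq_zero_of_lt (p : ℕ) {r n : ℕ} (h : n < r) : spanProb p r n = 0 :=
  Finset.prod_eq_zero (Finset.mem_range.2 h) (by simp)

/-- Row rank equals column rank: the `n` rows of an `n × r` matrix span `𝔽_p^r` iff its `r` columns
are independent in `𝔽_p^n`, and independent families are counted by `∏ (p^n - p^i)`. -/
lemma card_spanning_pi (p : ℕ) [Fact p.Prime] (r n : ℕ) :
    (Nat.card {y : Fin n → (Fin r → ZMod p) // Submodule.span (ZMod p) (Set.range y) = ⊤} : ℝ) =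
      spanProb p r n * ((p : ℝ) ^ r) ^ n := by
  have hp : (0 : ℝ) < p := by exact_mod_cast (Fact.out : p.Prime).pos
  have hiff (y : Fin n → (Fin r → ZMod p)) : Submodule.span (ZMod p) (Set.range y) = ⊤ ↔
      LinearIndependent (ZMod p) (Function.swap y) := by
    have h1 := Matrix.rank_eq_finrank_span_cols (Matrix.of y)
    have h2 := Matrix.rank_eq_finrank_span_row (Matrix.of y)
    rw [linearIndependent_iff_card_eq_finrank_span, Set.finrank]
    change _ = Module.finrank (ZMod p) (Submodule.span (ZMod p) (Set.range (Function.swap y))) at h1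
    change _ = Module.finrank (ZMod p) (Submodule.span (ZMod p) (Set.range y)) at h2
    rw [← h1, h2]
    constructor
    · intro h
      rw [h]
      simp
    · intro h
      apply Submodule.eq_top_of_finrank_eq
      rw [← h]
      simp
  have e : {y : Fin n → (Fin r → ZMod p) // Submodule.span (ZMod p) (Set.range y) = ⊤} ≃
      {z : Fin r → (Fin n → ZMod p) // LinearIndependent (ZMod p) z} :=
    (Equiv.piComm _).subtypeEquiv hiff
  rw [Nat.card_congr e]
  rcases lt_or_ge n r with h | h
  · rw [spanProb_eq_zero_of_lt p h, zero_mul, Nat.cast_eq_zero, Nat.card_eq_zero]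
    refine Or.inl ⟨fun z => ?_⟩
    have := z.2.fintype_card_le_finrank
    simp at this
    omega
  · rw [card_linearIndependent (by simpa using h), Nat.cast_prod, ← pow_mul, mul_comm r n, pow_mul,
      spanProb, ← Fin.prod_univ_eq_prod_range (fun i => 1 - (p : ℝ) ^ (-((n : ℤ) - (i : ℤ)))) r]
    have hpow : ((p : ℝ) ^ n) ^ r = ∏ _i : Fin r, (p : ℝ) ^ n := by simp
    rw [hpow, ← Finset.prod_mul_distrib]
    refine Finset.prod_congr rfl fun i _ => ?_
    rw [ZMod.card, Module.finrank_fin_fun, Nat.cast_sub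
      (Nat.pow_le_pow_right (Fact.out : p.Prime).pos (by omega)), sub_mul, one_mul,
      ← zpow_natCast (p : ℝ) n, ← zpow_add₀ hp.ne']
    simp

lemma card_spanning (p : ℕ) [Fact p.Prime] (V : Type*) [AddCommGroup V] [Module (ZMod p) V]
    [Finite V] (n : ℕ) :
    (Nat.card {y : Fin n → V // Submodule.span (ZMod p) (Set.range y) = ⊤} : ℝ) =
      spanProb p (Module.finrank (ZMod p) V) n * (Nat.card V : ℝ) ^ n := by
  have : Module.Finite (ZMod p) V := Module.Finite.of_finite
  let φ : V ≃ₗ[ZMod p] (Fin (Module.finrank (ZMod p) V) → ZMod p) :=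
    (Module.finBasis (ZMod p) V).equivFun
  have e : {y : Fin n → V // Submodule.span (ZMod p) (Set.range y) = ⊤} ≃
      {y : Fin n → (Fin (Module.finrank (ZMod p) V) → ZMod p) //
        Submodule.span (ZMod p) (Set.range y) = ⊤} := by
    refine (Equiv.arrowCongr (Equiv.refl _) φ.toEquiv).subtypeEquiv fun y => ?_
    have : Set.range ((Equiv.arrowCongr (Equiv.refl _) φ.toEquiv) y) =
        φ.toLinearMap '' Set.range y := by
      rw [← Set.range_comp]
      rfl
    rw [this, Submodule.span_image]
    constructor
    · intro h
      rw [h, Submodule.map_top, LinearEquiv.range]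
    · intro h
      rw [← LinearMap.range_eq_top.2 φ.surjective, ← Submodule.map_top] at h
      exact Submodule.map_injective_of_injective φ.injective h
  rw [Nat.card_congr e, card_spanning_pi, Nat.card_congr φ.toEquiv]
  simp

/-- A set-theoretic section of `f` identifies the preimage of `T` with `T × ker f`. -/
lemma card_preimage_mul_card {A B : Type*} [AddGroup A] [AddGroup B] (f : A →+ B)
    (hf : Function.Surjective f) (T : Set B) :
    Nat.card (f ⁻¹' T) * Nat.card B = Nat.card T * Nat.card A := by
  have key (T : Set B) : Nat.card (f ⁻¹' T) = Nat.card T * Nat.card f.ker := by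
    rw [← Nat.card_prod]
    refine Nat.card_congr
      { toFun := fun a => (⟨f a, a.2⟩, ⟨a - Function.surjInv hf (f a), ?_⟩)
        invFun := fun x => ⟨x.2 + Function.surjInv hf x.1, ?_⟩
        left_inv := ?_
        right_inv := ?_ }
    · simp [AddMonoidHom.mem_ker, Function.surjInv_eq]
    · rw [Set.mem_preimage, map_add, AddMonoidHom.mem_ker.1 x.2.2, Function.surjInv_eq hf, zero_add]
      exact x.1.2
    · intro a
      simp
    · rintro ⟨⟨t, ht⟩, ⟨k, hk⟩⟩
      rw [AddMonoidHom.mem_ker] at hk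
      simp [hk, Function.surjInv_eq]
  have h := key Set.univ
  rw [Set.preimage_univ, Nat.card_congr (Equiv.Set.univ A), Nat.card_congr (Equiv.Set.univ B)] at h
  rw [key, h]
  ring

/-! ### Generation tested on the quotients `A/pA` -/

section Quotients

variable {A : Type*} [AddCommGroup A]

lemma modN_mkQ_surjective (p : ℕ) : Function.Surjective (ModN.mkQ p : A →+ ModN A p) :=
  Submodule.mkQ_surjective _

lemma modN_mkQ_eq_zero_iff (p : ℕ) (a : A) : ModN.mkQ p a = 0 ↔ ∃ b : A, p • b = a := by
  refine (Submodule.Quotient.mk_eq_zero _).trans ?_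
  simp [LinearMap.mem_range]

lemma nsmul_modN_eq_zero (p : ℕ) (x : ModN A p) : p • x = 0 := by
  obtain ⟨a, rfl⟩ := modN_mkQ_surjective p x
  rw [← map_nsmul, modN_mkQ_eq_zero_iff]
  exact ⟨a, rfl⟩

lemma pi_modN_mkQ_surjective (S : Finset ℕ) (hS : ∀ p ∈ S, p.Prime) :
    Function.Surjective (AddMonoidHom.pi fun p : S => (ModN.mkQ (p : ℕ) : A →+ ModN A p)) := by
  classical
  intro z
  choose a ha using fun p : S => modN_mkQ_surjective (p : ℕ) (z p)
  have hcop (p : S) : (∏ q ∈ Finset.univ.erase p, (q : ℕ)).Coprime p :=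
    Nat.Coprime.prod_left fun q hq => (Nat.coprime_primes (hS _ q.2) (hS _ p.2)).2
      fun h => (Finset.ne_of_mem_erase hq) (Subtype.ext h)
  -- `u p` inverts the product of the other primes modulo `p`, so the coefficient of `a p` below is
  -- `1` modulo `p` and `0` modulo every other prime of `S`.
  choose u hu using fun p : S => Nat.exists_mul_mod_eq_one_of_coprime (hcop p) (hS _ p.2).one_lt
  refine ⟨∑ p : S, ((∏ q ∈ Finset.univ.erase p, (q : ℕ)) * u p) • a p, ?_⟩
  ext p
  rw [AddMonoidHom.pi_apply, map_sum, Finset.sum_eq_single p]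
  · rw [map_nsmul, ha]
    conv_lhs => rw [← Nat.div_add_mod ((∏ q ∈ Finset.univ.erase p, (q : ℕ)) * u p) p, (hu p).2]
    rw [add_nsmul, mul_nsmul, nsmul_modN_eq_zero, nsmul_zero, zero_add, one_nsmul]
  · intro q _ hqp
    rw [map_nsmul]
    obtain ⟨c, hc⟩ : (p : ℕ) ∣ (∏ q ∈ Finset.univ.erase q, (q : ℕ)) * u q :=
      (Finset.dvd_prod_of_mem _ (Finset.mem_erase.2 ⟨hqp.symm, Finset.mem_univ p⟩)).mul_right _
    rw [hc, mul_nsmul, nsmul_modN_eq_zero, nsmul_zero]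
  · simp

/-- Take a prime `p` dividing the index of `H`. If `H + pA = A`, multiplication by `p` is surjective
on the finite group `A/H`, hence injective, which contradicts Cauchy's theorem. -/
lemma exists_prime_map_mkQ_ne_top [Finite A] {H : AddSubgroup A} (hH : H ≠ ⊤) :
    ∃ p ∈ (Nat.card A).primeFactors, H.map (ModN.mkQ p) ≠ ⊤ := by
  have hcard : Nat.card (A ⧸ H) ≠ 1 := by
    rwa [← AddSubgroup.index_eq_card, Ne, AddSubgroup.index_eq_one]
  obtain ⟨p, hp, hpd⟩ := Nat.exists_prime_and_dvd hcard
  have := Fact.mk hp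
  refine ⟨p, Nat.mem_primeFactors.2 ⟨hp, hpd.trans (AddSubgroup.card_quotient_dvd_card H),
    Nat.card_pos.ne'⟩, fun htop => ?_⟩
  have hsurj : Function.Surjective (fun x : A ⧸ H => p • x) := by
    intro x
    obtain ⟨a, rfl⟩ := QuotientAddGroup.mk_surjective x
    obtain ⟨h, hh, hha⟩ : ModN.mkQ p a ∈ H.map (ModN.mkQ p) := by rw [htop]; trivial
    obtain ⟨b, hb⟩ := (modN_mkQ_eq_zero_iff p (a - h)).1 (by rw [map_sub, hha, sub_self])
    refine ⟨(b : A ⧸ H), ?_⟩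
    change p • (b : A ⧸ H) = a
    rw [← QuotientAddGroup.mk_nsmul, hb, QuotientAddGroup.mk_sub,
      (QuotientAddGroup.eq_zero_iff h).2 hh, sub_zero]
  obtain ⟨x, hx⟩ := exists_prime_addOrderOf_dvd_card' p hpd
  have h0 : x = 0 := (Finite.injective_iff_surjective.2 hsurj) (by
    change p • x = p • 0
    rw [← hx, addOrderOf_nsmul_eq_zero, nsmul_zero])
  rw [h0, addOrderOf_zero] at hx
  exact hp.one_lt.ne hx

lemma closure_eq_top_iff_forall_span [Finite A] {ι : Type*} (y : ι → A) :
    AddSubgroup.closure (Set.range y) = ⊤ ↔ ∀ p ∈ (Nat.card A).primeFactors,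
      Submodule.span (ZMod p) (Set.range fun i => ModN.mkQ p (y i)) = ⊤ := by
  have key (p : ℕ) : Submodule.span (ZMod p) (Set.range fun i => ModN.mkQ p (y i)) =
      AddSubgroup.toZModSubmodule p ((AddSubgroup.closure (Set.range y)).map (ModN.mkQ p)) := by
    rw [AddMonoidHom.map_closure, ← Set.range_comp]
    apply le_antisymm
    · rw [Submodule.span_le]
      exact AddSubgroup.subset_closure
    · rw [← OrderIso.le_symm_apply, AddSubgroup.toZModSubmodule_symm, AddSubgroup.closure_le]
      exact Submodule.subset_span
  simp_rw [key, map_eq_top_iff]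
  constructor
  · intro h p _
    rw [h]
    exact AddSubgroup.map_top_of_surjective _ (modN_mkQ_surjective p)
  · intro h
    by_contra hH
    obtain ⟨p, hp, hne⟩ := exists_prime_map_mkQ_ne_top hH
    exact hne (h p hp)

/-- Generating tuples are the preimage of a product of spanning conditions under the surjection from
`A^n` to `(∏ A/pA)^n`, and surjective homomorphisms preserve proportions. -/
lemma card_generating_tuples [Finite A] (n : ℕ) :
    (Nat.card {y : Fin n → A | AddSubgroup.closure (Set.range y) = ⊤} : ℝ) / (Nat.card A : ℝ) ^ n =
      ∏ p ∈ (Nat.card A).primeFactors, spanProb p (Module.finrank (ZMod p) (ModN A p)) n := by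
  set S := (Nat.card A).primeFactors
  have hS (p : S) : Fact (p : ℕ).Prime := ⟨Nat.prime_of_mem_primeFactors p.2⟩
  have hfin (p : S) : Finite (ModN A (p : ℕ)) := Finite.of_surjective _ (modN_mkQ_surjective (p : ℕ))
  let π : A →+ (p : S) → ModN A (p : ℕ) := AddMonoidHom.pi fun p : S => ModN.mkQ (p : ℕ)
  have hπ : Function.Surjective π :=
    pi_modN_mkQ_surjective S fun p hp => Nat.prime_of_mem_primeFactors hp
  let T : Set (Fin n → (p : S) → ModN A (p : ℕ)) :=
    {z | ∀ p : S, Submodule.span (ZMod p) (Set.range fun i => z i p) = ⊤}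
  have hT : (Nat.card T : ℝ) = (∏ p ∈ S, spanProb p (Module.finrank (ZMod p) (ModN A p)) n) *
      (Nat.card ((p : S) → ModN A (p : ℕ)) : ℝ) ^ n := by
    let e : T ≃ ((p : S) → {w : Fin n → ModN A (p : ℕ) //
        Submodule.span (ZMod p) (Set.range w) = ⊤}) :=
      { toFun := fun z p => ⟨fun i => z.1 i p, z.2 p⟩
        invFun := fun w => ⟨fun i p => (w p).1 i, fun p => (w p).2⟩
        left_inv := fun _ => rfl
        right_inv := fun _ => rfl }
    rw [Nat.card_congr e, Nat.card_pi, Nat.card_pi, Nat.cast_prod, Nat.cast_prod,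
      ← Finset.prod_pow, ← Finset.prod_coe_sort S, ← Finset.prod_mul_distrib]
    exact Finset.prod_congr rfl fun p _ => card_spanning p _ n
  have hpre : {y : Fin n → A | AddSubgroup.closure (Set.range y) = ⊤} = π.compLeft (Fin n) ⁻¹' T := by
    ext y
    simp only [Set.mem_ofPred_eq, closure_eq_top_iff_forall_span, Set.mem_preimage, T,
      Subtype.forall]
    rfl
  have hsurj : Function.Surjective (π.compLeft (Fin n)) := hπ.comp_left
  have h := card_preimage_mul_card (π.compLeft (Fin n)) hsurj T
  rw [← hpre, Nat.card_fun, Nat.card_fun, Nat.card_fin] at h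
  have hA : (0 : ℝ) < Nat.card A := by exact_mod_cast Nat.card_pos
  have hB : (0 : ℝ) < Nat.card ((p : S) → ModN A (p : ℕ)) := by exact_mod_cast Nat.card_pos
  have h' : (Nat.card {y : Fin n → A | AddSubgroup.closure (Set.range y) = ⊤} : ℝ) *
      (Nat.card ((p : S) → ModN A (p : ℕ)) : ℝ) ^ n =
      Nat.card T * (Nat.card A : ℝ) ^ n := by exact_mod_cast h
  rw [hT] at h'
  rw [div_eq_iff (by positivity)]
  refine mul_right_cancel₀ (pow_ne_zero n hB.ne') (h'.trans ?_)
  ring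

end Quotients

/-! ### Convergence and the general formula -/

lemma genProb_eq (G : Type*) [CommGroup G] [Finite G] (n : ℕ) :
    genProb G n = ∏ p ∈ (Nat.card G).primeFactors, spanProb p (pRank G p) n := by
  have e : {y : Fin n → G | Subgroup.closure (Set.range y) = ⊤} ≃
      {y : Fin n → Additive G | AddSubgroup.closure (Set.range y) = ⊤} := by
    refine (Equiv.arrowCongr (Equiv.refl _) Additive.ofMul).subtypeEquiv fun y => ?_
    change Subgroup.closure (Set.range y) = ⊤ ↔
      AddSubgroup.closure (Additive.toMul ⁻¹' Set.range y) = ⊤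
    rw [← Subgroup.toAddSubgroup_closure, map_eq_top_iff]
  rw [genProb, Nat.card_congr e]
  exact card_generating_tuples (A := Additive G) n

lemma hasSum_two_mul_add_one_mul_geometric {x : ℝ} (h0 : 0 ≤ x) (h1 : x < 1) :
    HasSum (fun n : ℕ => (2 * n + 1 : ℝ) * x ^ n) ((1 + x) / (1 - x) ^ 2) := by
  have hx : 1 - x ≠ 0 := (sub_pos.2 h1).ne'
  have h := ((hasSum_coe_mul_geometric_of_norm_lt_one
    (by rwa [Real.norm_of_nonneg h0] : ‖x‖ < 1)).mul_left 2).add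
    (hasSum_geometric_of_lt_one h0 h1)
  convert! h using 1
  · ext n
    ring
  · field_simp
    ring

lemma spanProb_zero (p n : ℕ) : spanProb p 0 n = 1 := by simp [spanProb]

lemma spanProb_succ (p r n : ℕ) :
    spanProb p (r + 1) n = spanProb p r n * (1 - (p : ℝ) ^ (-((n : ℤ) - (r : ℤ)))) := by
  rw [spanProb, Finset.prod_range_succ, spanProb]

lemma spanProb_mem_Icc {p : ℕ} (hp : 1 < p) (r n : ℕ) : spanProb p r n ∈ Set.Icc (0 : ℝ) 1 := by
  have hp' : (1 : ℝ) < p := by exact_mod_cast hp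
  induction r with
  | zero => simp [spanProb_zero]
  | succ r ih =>
    rcases lt_or_ge n (r + 1) with h | h
    · simp [spanProb_eq_zero_of_lt p h]
    · have h0 : 0 < (p : ℝ) ^ (-((n : ℤ) - (r : ℤ))) := by positivity
      have h1 : (p : ℝ) ^ (-((n : ℤ) - (r : ℤ))) ≤ 1 := zpow_le_one_of_nonpos₀ hp'.le (by omega)
      rw [spanProb_succ]
      exact ⟨mul_nonneg ih.1 (by linarith), mul_le_one₀ ih.2 (by linarith) (by linarith)⟩

/-- Each new factor adds at most `p^r p^{-n}` to the defect `1 - spanProb`, so the weighted sum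
stays dominated by geometric-type series. -/
lemma summable_mul_one_sub_spanProb {p : ℕ} (hp : 1 < p) (r : ℕ) :
    Summable fun n : ℕ => (2 * n + 1 : ℝ) * (1 - spanProb p r n) := by
  have hp' : (1 : ℝ) < p := by exact_mod_cast hp
  induction r with
  | zero => simp [spanProb_zero]
  | succ r ih =>
    have hg := (hasSum_two_mul_add_one_mul_geometric (x := (p : ℝ)⁻¹) (by positivity)
      (inv_lt_one_of_one_lt₀ hp')).summable.mul_left ((p : ℝ) ^ r)
    refine Summable.of_nonneg_of_le (fun n => ?_) (fun n => ?_) (ih.add hg)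
    · exact mul_nonneg (by positivity) (sub_nonneg.2 (spanProb_mem_Icc hp _ _).2)
    · have hz : (p : ℝ) ^ (-((n : ℤ) - (r : ℤ))) = (p : ℝ) ^ r * (p : ℝ)⁻¹ ^ n := by
        rw [neg_sub, zpow_sub₀ (by positivity)]
        simp [div_eq_mul_inv]
      have hs := spanProb_mem_Icc hp r n
      have h0 : 0 ≤ (p : ℝ) ^ r * (p : ℝ)⁻¹ ^ n := by positivity
      rw [spanProb_succ, hz]
      calc (2 * n + 1 : ℝ) * (1 - spanProb p r n * (1 - (p : ℝ) ^ r * (p : ℝ)⁻¹ ^ n))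
          = (2 * n + 1) * ((1 - spanProb p r n) +
              spanProb p r n * ((p : ℝ) ^ r * (p : ℝ)⁻¹ ^ n)) := by ring
        _ ≤ (2 * n + 1) * ((1 - spanProb p r n) + 1 * ((p : ℝ) ^ r * (p : ℝ)⁻¹ ^ n)) := by
          gcongr
          exact hs.2
        _ = _ := by ring

lemma summable_mul_one_sub_prod {ι : Type*} (s : Finset ι) (f : ι → ℕ → ℝ) {w : ℕ → ℝ}
    (hw : ∀ n, 0 ≤ w n) (hf : ∀ i ∈ s, ∀ n, f i n ∈ Set.Icc (0 : ℝ) 1)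
    (hs : ∀ i ∈ s, Summable fun n => w n * (1 - f i n)) :
    Summable fun n => w n * (1 - ∏ i ∈ s, f i n) := by
  classical
  induction s using Finset.induction_on with
  | empty => simp
  | insert i s hi ih =>
    have hf' : ∀ j ∈ s, ∀ n, f j n ∈ Set.Icc (0 : ℝ) 1 :=
      fun j hj => hf j (Finset.mem_insert_of_mem hj)
    have hi' := hf i (Finset.mem_insert_self i s)
    have hP (n : ℕ) : ∏ j ∈ s, f j n ≤ 1 :=
      Finset.prod_le_one (fun j hj => (hf' j hj n).1) fun j hj => (hf' j hj n).2
    refine Summable.of_nonneg_of_le (fun n => ?_) (fun n => ?_)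
      ((hs i (Finset.mem_insert_self i s)).add
        (ih hf' fun j hj => hs j (Finset.mem_insert_of_mem hj)))
    · exact mul_nonneg (hw n) (sub_nonneg.2
        (Finset.prod_le_one (fun j hj => (hf j hj n).1) fun j hj => (hf j hj n).2))
    · rw [Finset.prod_insert hi, ← mul_add]
      refine mul_le_mul_of_nonneg_left ?_ (hw n)
      -- For `a, b ≤ 1`, `1 - ab ≤ (1 - a) + (1 - b)` amounts to `(1 - a)(1 - b) ≥ 0`.
      nlinarith [mul_nonneg (sub_nonneg.2 (hi' n).2) (sub_nonneg.2 (hP n))]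

lemma summable_mul_one_sub_genProb (G : Type*) [CommGroup G] [Finite G] :
    Summable fun n : ℕ => (2 * n + 1 : ℝ) * (1 - genProb G n) := by
  simp_rw [genProb_eq]
  refine summable_mul_one_sub_prod _ (fun p n => spanProb p (pRank G p) n) (fun n => by positivity)
    (fun p hp n => ?_) fun p hp => ?_
  · exact spanProb_mem_Icc (Nat.prime_of_mem_primeFactors hp).one_lt _ _
  · exact summable_mul_one_sub_spanProb (Nat.prime_of_mem_primeFactors hp).one_lt _

lemma summable_one_sub_genProb (G : Type*) [CommGroup G] [Finite G] :
    Summable fun n : ℕ => 1 - genProb G n := by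
  refine Summable.of_nonneg_of_le (fun n => sub_nonneg.2 (genProb_le_one G n)) (fun n => ?_)
    (summable_mul_one_sub_genProb G)
  exact le_mul_of_one_le_left (sub_nonneg.2 (genProb_le_one G n))
    (by linarith [Nat.cast_nonneg (α := ℝ) n])

lemma genProb_eq_zero_of_lt_delta {G : Type*} [CommGroup G] [Finite G] {n : ℕ}
    (h : n < delta G) : genProb G n = 0 := by
  obtain ⟨p, hp, hlt⟩ := Finset.lt_sup_iff.1 h
  rw [genProb_eq]
  exact Finset.prod_eq_zero hp (spanProb_eq_zero_of_lt p hlt)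

/-- The series index `j = m + 1` matches the tail index `n = m + δ(G)`, and the inner index `i ≥ 1`
shifts to start at `0`. -/
lemma seriesTerm_succPNat (G : Type*) [CommGroup G] [Finite G] (m : ℕ) :
    seriesTerm G m.succPNat =
      (2 * ((m + delta G : ℕ) : ℝ) + 1) * (1 - genProb G (m + delta G)) := by
  rw [genProb_eq, seriesTerm]
  congr 1
  · push_cast [Nat.succPNat_coe]
    ring
  · congr 1
    refine Finset.prod_congr rfl fun p _ => ?_
    have hI : Finset.Icc 1 (pRank G p) = Finset.Ico (0 + 1) (pRank G p + 1) := rfl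
    rw [spanProb, Finset.range_eq_Ico, hI, ← Finset.prod_Ico_add']
    refine Finset.prod_congr rfl fun i _ => ?_
    congr 3
    push_cast [Nat.succPNat_coe]
    ring

lemma summable_seriesTerm (G : Type*) [CommGroup G] [Finite G] : Summable (seriesTerm G) := by
  rw [← Equiv.pnatEquivNat.symm.summable_iff]
  refine ((summable_nat_add_iff (delta G)).2 (summable_mul_one_sub_genProb G)).congr fun m => ?_
  exact (seriesTerm_succPNat G m).symm

lemma tsum_mul_one_sub_genProb_eq (G : Type*) [CommGroup G] [Finite G] :
    ∑' n : ℕ, (2 * n + 1 : ℝ) * (1 - genProb G n) =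
      (delta G : ℝ) ^ 2 + ∑' j : ℕ+, seriesTerm G j := by
  rw [← (summable_mul_one_sub_genProb G).sum_add_tsum_nat_add (delta G),
    ← Equiv.pnatEquivNat.symm.tsum_eq]
  congr 1
  · rw [Finset.sum_congr rfl (g := fun n : ℕ => (2 * n + 1 : ℝ))]
    · induction delta G with
      | zero => simp
      | succ m ih => rw [Finset.sum_range_succ, ih]; push_cast; ring
    · intro n hn
      rw [genProb_eq_zero_of_lt_delta (Finset.mem_range.1 hn)]
      ring
  · exact tsum_congr fun m => (seriesTerm_succPNat G m).symm

/-! ### Cyclic groups -/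

section Cyclic

lemma finrank_modN_zmod {n p : ℕ} [Fact p.Prime] (h : p ∣ n) :
    Module.finrank (ZMod p) (ModN (ZMod n) p) = 1 := by
  have hne : (ModN.mkQ p (1 : ZMod n) : ModN (ZMod n) p) ≠ 0 := by
    rw [Ne, modN_mkQ_eq_zero_iff]
    rintro ⟨b, hb⟩
    -- Reduction modulo `p` kills `p • b` but sends `1` to `1`.
    have := congrArg (ZMod.castHom h (ZMod p)) hb
    rw [map_nsmul, map_one] at this
    simp at this
  rw [finrank_eq_one_iff_of_nonzero' _ hne]
  intro w
  obtain ⟨a, rfl⟩ := modN_mkQ_surjective p w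
  obtain ⟨k, rfl⟩ := ZMod.intCast_surjective a
  refine ⟨(k : ZMod p), ?_⟩
  rw [Int.cast_smul_eq_zsmul, ← map_zsmul, zsmul_one]

/-- Expanding the product gives a sum over subsets of the prime factors, that is, over squarefree
divisors; `μ` vanishes on the others. -/
lemma prod_primeFactors_one_sub_inv_pow {n : ℕ} (hn : n ≠ 0) (m : ℕ) :
    ∏ p ∈ n.primeFactors, (1 - ((p : ℝ)⁻¹) ^ m) =
      ∑ d ∈ n.divisors, (ArithmeticFunction.moebius d : ℝ) * ((d : ℝ)⁻¹) ^ m := by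
  have h1 : ∑ d ∈ n.divisors, (ArithmeticFunction.moebius d : ℝ) * ((d : ℝ)⁻¹) ^ m =
      ∑ d ∈ n.divisors with Squarefree d,
        (ArithmeticFunction.moebius d : ℝ) * ((d : ℝ)⁻¹) ^ m := by
    rw [Finset.sum_filter]
    refine Finset.sum_congr rfl fun d _ => ?_
    split_ifs with h
    · rfl
    · simp [ArithmeticFunction.moebius_eq_zero_of_not_squarefree h]
  rw [h1, Nat.sum_divisors_filter_squarefree hn]
  have hfac : (UniqueFactorizationMonoid.normalizedFactors n).toFinset = n.primeFactors := by
    rw [Nat.factors_eq]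
    rfl
  simp_rw [hfac, sub_eq_add_neg]
  rw [Finset.prod_one_add]
  refine Finset.sum_congr rfl fun t ht => ?_
  simp_rw [Finset.prod_val, id]
  rw [ArithmeticFunction.isMultiplicative_moebius.map_prod_of_subset_primeFactors n
    t (Finset.mem_powerset.1 ht)]
  push_cast
  rw [← Finset.prod_inv_distrib, ← Finset.prod_pow, ← Finset.prod_mul_distrib]
  refine Finset.prod_congr rfl fun p hp => ?_
  rw [ArithmeticFunction.moebius_apply_prime
    (Nat.prime_of_mem_primeFactors (Finset.mem_powerset.1 ht hp))]
  simp

lemma genProb_zmod {n : ℕ} (hn : n ≠ 0) (m : ℕ) :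
    genProb (Multiplicative (ZMod n)) m =
      ∑ d ∈ n.divisors, (ArithmeticFunction.moebius d : ℝ) * ((d : ℝ)⁻¹) ^ m := by
  have := NeZero.mk hn
  rw [genProb_eq, ← prod_primeFactors_one_sub_inv_pow hn]
  have hc : Nat.card (Multiplicative (ZMod n)) = n := Nat.card_zmod n
  rw [hc]
  refine Finset.prod_congr rfl fun p hp => ?_
  have := Fact.mk (Nat.prime_of_mem_primeFactors hp)
  have hr : pRank (Multiplicative (ZMod n)) p = 1 :=
    finrank_modN_zmod (Nat.dvd_of_mem_primeFactors hp)
  rw [hr, spanProb_succ, spanProb_zero]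
  simp

lemma hasSum_mul_one_sub_genProb_zmod {n : ℕ} (hn : n ≠ 0) :
    HasSum (fun m : ℕ => (2 * m + 1 : ℝ) * (1 - genProb (Multiplicative (ZMod n)) m))
      (-∑ d ∈ n.divisors with 2 ≤ d, (ArithmeticFunction.moebius d : ℝ) *
        ((1 + (d : ℝ)⁻¹) / (1 - (d : ℝ)⁻¹) ^ 2)) := by
  have h : HasSum (fun m : ℕ => -∑ d ∈ n.divisors with 2 ≤ d,
      (ArithmeticFunction.moebius d : ℝ) * ((2 * m + 1 : ℝ) * ((d : ℝ)⁻¹) ^ m))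
      (-∑ d ∈ n.divisors with 2 ≤ d, (ArithmeticFunction.moebius d : ℝ) *
        ((1 + (d : ℝ)⁻¹) / (1 - (d : ℝ)⁻¹) ^ 2)) := by
    refine (hasSum_sum fun d hd => ?_).neg
    have hd2 : (1 : ℝ) < d := by exact_mod_cast (Finset.mem_filter.1 hd).2
    exact (hasSum_two_mul_add_one_mul_geometric (by positivity)
      (inv_lt_one_of_one_lt₀ hd2)).mul_left _
  refine h.congr_fun fun m => ?_
  -- The divisor `1` is split off: its term is `1` and cancels the `1` in `1 - genProb`.
  have hd : n.divisors = insert 1 (n.divisors.filter (2 ≤ ·)) := by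
    ext d
    simp only [Finset.mem_insert, Finset.mem_filter, Nat.mem_divisors]
    constructor
    · intro h
      have := Nat.pos_of_dvd_of_pos h.1 (Nat.pos_of_ne_zero hn)
      by_cases hd : d = 1
      · exact Or.inl hd
      · exact Or.inr ⟨h, by omega⟩
    · rintro (rfl | h)
      · exact ⟨one_dvd n, hn⟩
      · exact h.1
  rw [genProb_zmod hn]
  conv_lhs => rw [hd]
  rw [Finset.sum_insert (by simp)]
  simp only [ArithmeticFunction.moebius_apply_one, Int.cast_one, Nat.cast_one, inv_one, one_pow,
    mul_one, sub_add_cancel_left, mul_neg, Finset.mul_sum]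
  congr 1
  exact Finset.sum_congr rfl fun d _ => by ring

end Cyclic

/-! ### Elementary abelian groups -/

section ElementaryAbelian

lemma finrank_modN_of_module (p : ℕ) (V : Type*) [AddCommGroup V] [Module (ZMod p) V] :
    Module.finrank (ZMod p) (ModN V p) = Module.finrank (ZMod p) V := by
  let f : V →ₗ[ZMod p] ModN V p := (ModN.mkQ p : V →+ ModN V p).toZModLinearMap p
  have hf : Function.Bijective f := by
    refine ⟨(injective_iff_map_eq_zero f).2 fun a ha => ?_, modN_mkQ_surjective p⟩
    obtain ⟨b, rfl⟩ := (modN_mkQ_eq_zero_iff p a).1 ha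
    rw [← Nat.cast_smul_eq_nsmul (ZMod p), CharP.cast_eq_zero, zero_smul]
  exact (LinearEquiv.ofBijective f hf).finrank_eq.symm

lemma genProb_pi_zmod {p k : ℕ} (hp : p.Prime) (hk : k ≠ 0) (n : ℕ) :
    genProb (Multiplicative (Fin k → ZMod p)) n = spanProb p k n := by
  have := Fact.mk hp
  have hc : Nat.card (Multiplicative (Fin k → ZMod p)) = p ^ k := by
    change Nat.card (Fin k → ZMod p) = p ^ k
    simp
  have hr : pRank (Multiplicative (Fin k → ZMod p)) p = k :=
    (finrank_modN_of_module p (Fin k → ZMod p)).trans (by simp)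
  rw [genProb_eq, hc, Nat.primeFactors_prime_pow hk hp, Finset.prod_singleton, hr]

/-- Condition on the first vector of `𝔽_p^{k+1}`: with probability `p^{-(k+1)}` it is zero and the
other `n` must span everything; otherwise they need only span the quotient by its line. The proof is
algebraic. -/
lemma one_sub_spanProb_succ_succ {p : ℕ} (hp : 0 < p) (k n : ℕ) :
    1 - spanProb p (k + 1) (n + 1) = ((p : ℝ)⁻¹ ^ (k + 1)) * (1 - spanProb p (k + 1) n) +
      (1 - (p : ℝ)⁻¹ ^ (k + 1)) * (1 - spanProb p k n) := by
  have hp' : (p : ℝ) ≠ 0 := by exact_mod_cast hp.ne'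
  have h1 : spanProb p (k + 1) (n + 1) = (1 - (p : ℝ)⁻¹ ^ (n + 1)) * spanProb p k n := by
    rw [spanProb, Finset.prod_range_succ', mul_comm, spanProb]
    congr 1
    · rw [inv_pow, ← zpow_natCast, ← zpow_neg]
      simp
    · refine Finset.prod_congr rfl fun i _ => ?_
      congr 3
      push_cast
      ring
  have h2 : (p : ℝ)⁻¹ ^ (k + 1) * (p : ℝ) ^ (-((n : ℤ) - (k : ℤ))) = (p : ℝ)⁻¹ ^ (n + 1) := by
    rw [inv_pow, inv_pow, ← zpow_natCast, ← zpow_natCast, ← zpow_neg, ← zpow_neg, ← zpow_add₀ hp']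
    congr 1
    push_cast
    ring
  rw [h1, spanProb_succ, ← h2]
  ring

lemma spanProb_zero_right (p k : ℕ) : spanProb p (k + 1) 0 = 0 :=
  spanProb_eq_zero_of_lt p k.succ_pos

lemma summable_one_sub_spanProb {p : ℕ} (hp : 1 < p) (r : ℕ) :
    Summable fun n : ℕ => 1 - spanProb p r n := by
  have h (n : ℕ) : 0 ≤ 1 - spanProb p r n := sub_nonneg.2 (spanProb_mem_Icc hp r n).2
  refine Summable.of_nonneg_of_le h (fun n => ?_) (summable_mul_one_sub_spanProb hp r)
  exact le_mul_of_one_le_left (h n) (by linarith [Nat.cast_nonneg (α := ℝ) n])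

lemma tsum_one_sub_spanProb_succ {p : ℕ} (hp : 1 < p) (k : ℕ) :
    (1 - (p : ℝ)⁻¹ ^ (k + 1)) * ∑' n, (1 - spanProb p (k + 1) n) =
      1 + (1 - (p : ℝ)⁻¹ ^ (k + 1)) * ∑' n, (1 - spanProb p k n) := by
  have h := (summable_one_sub_spanProb hp (k + 1)).tsum_eq_zero_add
  simp_rw [one_sub_spanProb_succ_succ (zero_lt_one.trans hp), spanProb_zero_right] at h
  rw [((summable_one_sub_spanProb hp (k + 1)).mul_left _).tsum_add
    ((summable_one_sub_spanProb hp k).mul_left _), tsum_mul_left, tsum_mul_left] at h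
  linarith

/-- Summing the recursion with weights `2(n+1)+1 = (2n+1) + 2` makes the first-moment series appear.
-/
lemma tsum_mul_one_sub_spanProb_succ {p : ℕ} (hp : 1 < p) (k : ℕ) :
    (1 - (p : ℝ)⁻¹ ^ (k + 1)) * ∑' n : ℕ, (2 * n + 1 : ℝ) * (1 - spanProb p (k + 1) n) =
      1 + 2 * (p : ℝ)⁻¹ ^ (k + 1) * ∑' n, (1 - spanProb p (k + 1) n) +
      (1 - (p : ℝ)⁻¹ ^ (k + 1)) * (∑' n : ℕ, (2 * n + 1 : ℝ) * (1 - spanProb p k n) +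
        2 * ∑' n, (1 - spanProb p k n)) := by
  have h := (summable_mul_one_sub_spanProb hp (k + 1)).tsum_eq_zero_add
  have e (n : ℕ) : (2 * ((n + 1 : ℕ) : ℝ) + 1) * (1 - spanProb p (k + 1) (n + 1)) =
      ((p : ℝ)⁻¹ ^ (k + 1)) * ((2 * n + 1) * (1 - spanProb p (k + 1) n) +
        2 * (1 - spanProb p (k + 1) n)) +
      (1 - (p : ℝ)⁻¹ ^ (k + 1)) * ((2 * n + 1) * (1 - spanProb p k n) +
        2 * (1 - spanProb p k n)) := by
    rw [one_sub_spanProb_succ_succ (zero_lt_one.trans hp)]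
    push_cast
    ring
  simp_rw [e, spanProb_zero_right] at h
  have s1 := summable_mul_one_sub_spanProb hp (k + 1)
  have s2 := (summable_one_sub_spanProb hp (k + 1)).mul_left 2
  have s3 := summable_mul_one_sub_spanProb hp k
  have s4 := (summable_one_sub_spanProb hp k).mul_left 2
  rw [((s1.add s2).mul_left _).tsum_add ((s3.add s4).mul_left _), tsum_mul_left, tsum_mul_left,
    s1.tsum_add s2, s3.tsum_add s4, tsum_mul_left, tsum_mul_left] at h
  push_cast at h
  linarith

lemma tsum_mul_one_sub_spanProb_eq {p : ℕ} (hp : 1 < p) (k : ℕ) :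
    ∑' n : ℕ, (2 * n + 1 : ℝ) * (1 - spanProb p k n) =
      (∑' n, (1 - spanProb p k n)) ^ 2 +
        ∑ j ∈ Finset.Icc 1 k, (p : ℝ) ^ j / ((p : ℝ) ^ j - 1) ^ 2 := by
  have hp' : (1 : ℝ) < p := by exact_mod_cast hp
  induction k with
  | zero => simp [spanProb_zero]
  | succ k ih =>
    have hE := tsum_one_sub_spanProb_succ hp k
    have hS := tsum_mul_one_sub_spanProb_succ hp k
    rw [Finset.sum_Icc_succ_top (by omega), ← add_assoc]
    rw [ih] at hS
    generalize ∑ j ∈ Finset.Icc 1 k, (p : ℝ) ^ j / ((p : ℝ) ^ j - 1) ^ 2 = V at *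
    generalize ∑' n, (1 - spanProb p (k + 1) n) = E at *
    generalize ∑' n, (1 - spanProb p k n) = F at *
    generalize ∑' n : ℕ, (2 * n + 1 : ℝ) * (1 - spanProb p (k + 1) n) = S at *
    have hq : (1 : ℝ) < (p : ℝ) ^ (k + 1) := one_lt_pow₀ hp' (by omega)
    rw [inv_pow] at hE hS
    generalize (p : ℝ) ^ (k + 1) = Q at *
    have hQ : Q ≠ 0 := by positivity
    have hQ1 : Q - 1 ≠ 0 := (sub_pos.2 hq).ne'
    -- With `Q = p^{k+1}`, the mean grows by `Q/(Q-1)`, the mean of the added geometric variable;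
    -- the variance then grows by `Q/(Q-1)²`.
    have hE' : E = F + Q / (Q - 1) := by
      field_simp at hE ⊢
      linarith
    subst hE'
    have hS' : S = (Q / (Q - 1)) * (1 + 2 * Q⁻¹ * (F + Q / (Q - 1)) +
        (1 - Q⁻¹) * (F ^ 2 + V + 2 * F)) := by
      rw [← hS]
      field_simp
    rw [hS']
    field_simp
    ring

end ElementaryAbelian

end Chebotarev

theorem theorem3p2 {Ω : Type*} [MeasurableSpace Ω] (P : Measure Ω) [IsProbabilityMeasure P] :
    (∀ (G : Type*) [CommGroup G] [Finite G] [Nontrivial G] (X : ℕ → Ω → G),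
      Chebotarev.IsIIDUniform P X →
        Chebotarev.scheb P X ≠ ⊤ ∧ Summable (Chebotarev.seriesTerm G) ∧
        (Chebotarev.scheb P X).toReal =
          (Chebotarev.delta G : ℝ) ^ 2 + ∑' j : ℕ+, Chebotarev.seriesTerm G j) ∧
    (∀ (n : ℕ), 2 ≤ n → ∀ X : ℕ → Ω → Multiplicative (ZMod n),
      Chebotarev.IsIIDUniform P X →
        Chebotarev.scheb P X ≠ ⊤ ∧
        (Chebotarev.scheb P X).toReal =
          -∑ d ∈ n.divisors with 2 ≤ d,
            (ArithmeticFunction.moebius d : ℝ) *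
              ((1 + (d : ℝ)⁻¹) / (1 - (d : ℝ)⁻¹) ^ 2)) ∧
    (∀ (p k : ℕ), p.Prime → 1 ≤ k → ∀ X : ℕ → Ω → Multiplicative (Fin k → ZMod p),
      Chebotarev.IsIIDUniform P X →
        Chebotarev.cheb P X ≠ ⊤ ∧ Chebotarev.scheb P X ≠ ⊤ ∧
        (Chebotarev.scheb P X).toReal =
          (Chebotarev.cheb P X).toReal ^ 2 +
            ∑ j ∈ Finset.Icc 1 k, (p : ℝ) ^ j / ((p : ℝ) ^ j - 1) ^ 2) := by
  refine ⟨fun G _ _ _ X hX => ?_, fun n hn X hX => ?_, fun p k hp hk X hX => ?_⟩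
  · have h := hX.scheb_eq (Chebotarev.summable_mul_one_sub_genProb G)
    refine ⟨h ▸ ENNReal.ofReal_ne_top, Chebotarev.summable_seriesTerm G, ?_⟩
    rw [h, ENNReal.toReal_ofReal
      (Chebotarev.tsum_mul_one_sub_genProb_nonneg fun _ => by positivity),
      Chebotarev.tsum_mul_one_sub_genProb_eq]
  · have := NeZero.mk (show n ≠ 0 by omega)
    have := Fact.mk (show 1 < n by omega)
    have h := hX.scheb_eq (Chebotarev.summable_mul_one_sub_genProb _)
    refine ⟨h ▸ ENNReal.ofReal_ne_top, ?_⟩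
    rw [h, ENNReal.toReal_ofReal
      (Chebotarev.tsum_mul_one_sub_genProb_nonneg fun _ => by positivity),
      (Chebotarev.hasSum_mul_one_sub_genProb_zmod (NeZero.ne n)).tsum_eq]
  · have := Fact.mk hp
    have := Fin.pos_iff_nonempty.1 hk
    have h := hX.scheb_eq (Chebotarev.summable_mul_one_sub_genProb _)
    have h' := hX.cheb_eq (Chebotarev.summable_one_sub_genProb _)
    refine ⟨h' ▸ ENNReal.ofReal_ne_top, h ▸ ENNReal.ofReal_ne_top, ?_⟩
    rw [h, h', ENNReal.toReal_ofReal
      (Chebotarev.tsum_mul_one_sub_genProb_nonneg fun _ => by positivity),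
      ENNReal.toReal_ofReal (tsum_nonneg fun n => sub_nonneg.2 (Chebotarev.genProb_le_one _ n))]
    simp_rw [Chebotarev.genProb_pi_zmod hp (Nat.pos_iff_ne_zero.1 hk)]
    exact Chebotarev.tsum_mul_one_sub_spanProb_eq hp.one_lt k
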